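/- For $p\in(0,1]$ let $G(n,p)$ be the binomial random graph on $n$ vertices, in which every pair of vertices is an edge independently with probability $p$. For a graph $G$ let $D(G,C_r^{\circlearrowright})$ be the number of orientations of $G$ that contain no directed cycle of length $r$ (as a not necessarily induced subdigraph). Let $r\ge 3$. There are constants $C>0$ and $k\in\mathbb N$, depending only on $r$, such that for every sequence $p=p(n)\in(0,1]$, with probability tending to $1$ as $n\to\infty$, $$\log D\big(G(n,p),C_r^{\circlearrowright}\big)\le C(\log n)^k\,\frac{n}{p},$$ that is, $\log D(G(n,p),C_r^{\circlearrowright})=\widetilde O(n/p)$. In fact, for every sequence $p=p(n)\in(0,1]$, with probability tending to $1$ as $n\to\infty$, $$D\big(G(n,p),C_r^{\circlearrowright}\big)\le \exp\bigg(\frac{6n(r-2)(\log n)^2}{p}\bigg).$$ -/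

import Mathlib

open Filter Topology

/-- `D` is an orientation of the simple graph `G`: every edge of `G` is given exactly one of its two
directions, and `D` has no other arcs (in particular, no loops). -/
def IsOrientation {V : Type*} (G : SimpleGraph V) (D : Digraph V) : Prop :=
  (∀ u v, G.Adj u v ↔ (D.Adj u v ∨ D.Adj v u)) ∧ ∀ u v, D.Adj u v → ¬ D.Adj v u

/-- `D` is `H`-free: `D` contains no copy of `H` as a (not necessarily induced) subdigraph. -/
def IsFreeOf {W V : Type*} (H : Digraph W) (D : Digraph V) : Prop :=
  ¬ ∃ f : W → V, Function.Injective f ∧ ∀ i j, H.Adj i j → D.Adj (f i) (f j)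

/-- `D(G, H)`: the number of `H`-free orientations of the graph `G`. -/
noncomputable def numFreeOrientations {W V : Type*} (G : SimpleGraph V) (H : Digraph W) : ℕ :=
  Nat.card {D : Digraph V // IsOrientation G D ∧ IsFreeOf H D}

/-- The directed cycle of length `r`: its vertices are the integers modulo `r` and its arcs are
`i → i + 1`. -/
def directedCycle (r : ℕ) : Digraph (ZMod r) where
  Adj i j := j = i + 1

/-- The event `E n` holds with high probability for the binomial random graph `G(n, p n)` on the
vertex set `Fin n`, i.e. its probability tends to `1` as `n → ∞`. -/
def WithHighProbability (p : ℕ → unitInterval) (E : (n : ℕ) → Set (SimpleGraph (Fin n))) : Prop :=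
  Tendsto (fun n : ℕ => SimpleGraph.binomialRandom (Fin n) (p n) (E n)) atTop (𝓝 1)

/-! With high probability every set of more than a = ⌊6 log n / p⌋ vertices spans an edge, by a
first moment bound. The rest is deterministic. Reveal the orientation vertex by vertex. When `v`
joins `T`, its neighbourhood N in `T` splits into at most a directed paths, by Gallai–Milgram
(`IsPathPartition.exists_card_le`). If v → u and w lies r - 2 steps after u on such a path, then w →
v would close a directed r-cycle, so v → w (`IsPathPartition.adj_of_mod_eq`). Hence on each path, in
each residue class modulo r - 2 of the distance to the end, the out-neighbours of `v` form a final
segment, coded by one vertex (`exists_threshold`). This gives at most n ^ ((r - 2) * a) extensions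
per vertex (`card_extensions_le`), and n such factors overall. -/

/-! ### Path partitions and the Gallai–Milgram theorem -/

/-- A partition of `S` into paths of the relation `R`: `e u` is the last vertex of the path through
`u`, and `d u` is the distance from `u` to `e u` along this path. The set of last vertices
is `X`. -/
structure IsPathPartition {V : Type*} (R : V → V → Prop) (S X : Finset V) (e : V → V)
    (d : V → ℕ) : Prop where
  mem_ends : ∀ u ∈ S, e u ∈ X
  ends_subset : X ⊆ S
  end_eq : ∀ x ∈ X, e x = x
  dist_end : ∀ x ∈ X, d x = 0
  injOn : ∀ u ∈ S, ∀ w ∈ S, e u = e w → d u = d w → u = w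
  exists_next : ∀ u ∈ S, ∀ k, d u = k + 1 → ∃ w ∈ S, e w = e u ∧ d w = k ∧ R u w

namespace IsPathPartition

variable {V : Type*} {R : V → V → Prop} {S X : Finset V} {e : V → V} {d : V → ℕ}

lemma singletons (R : V → V → Prop) (S : Finset V) :
    IsPathPartition R S S id (fun _ => 0) := by
  constructor <;> grind

lemma exists_of_le (h : IsPathPartition R S X e d) {u : V} (hu : u ∈ S) {k : ℕ} (hk : k ≤ d u) :
    ∃ w ∈ S, e w = e u ∧ d w = k := by
  induction hm : d u - k generalizing u with
  | zero => exact ⟨u, hu, rfl, by omega⟩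
  | succ m ih =>
    obtain ⟨w, hw, hew, hdw, -⟩ := h.exists_next u hu (d u - 1) (by omega)
    obtain ⟨z, hz, hez, hdz⟩ := ih hw (by omega) (by omega)
    exact ⟨z, hz, hez.trans hew, hdz⟩

lemma eq_of_dist_eq_zero (h : IsPathPartition R S X e d) {u : V} (hu : u ∈ S) (h0 : d u = 0) :
    e u = u := by
  have hx := h.mem_ends u hu
  exact h.injOn _ (h.ends_subset hx) _ hu (h.end_eq _ hx) (by rw [h.dist_end _ hx, h0])

/-- Along a path of the partition, the vertices between `u` and `w` form a directed path. -/
lemma exists_path (h : IsPathPartition R S X e d) {u w : V} (hu : u ∈ S) (hw : w ∈ S)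
    (he : e u = e w) {m : ℕ} (hd : d u = d w + m) :
    ∃ q : ℕ → V, q 0 = u ∧ q m = w ∧ (∀ i ≤ m, q i ∈ S) ∧ (∀ i < m, R (q i) (q (i + 1))) ∧
      ∀ i ≤ m, ∀ j ≤ m, q i = q j → i = j := by
  choose q hqS hqe hqd using fun i : ℕ => h.exists_of_le hu (Nat.sub_le (d u) i)
  refine ⟨q, ?_, ?_, fun i _ => hqS i, fun i hi => ?_, fun i hi j hj hij => ?_⟩
  · exact h.injOn _ (hqS 0) _ hu (hqe 0) (by rw [hqd]; omega)
  · exact h.injOn _ (hqS m) _ hw ((hqe m).trans he) (by rw [hqd]; omega)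
  · obtain ⟨z, hz, hez, hdz, hR⟩ := h.exists_next (q i) (hqS i) (d u - (i + 1))
      (by rw [hqd]; omega)
    have : z = q (i + 1) := h.injOn _ hz _ (hqS _) (by rw [hez, hqe, hqe]) (by rw [hdz, hqd])
    rwa [← this]
  · have := congrArg d hij
    rw [hqd, hqd] at this
    omega

variable [DecidableEq V]

/-- A new vertex `y` can be appended to the path ending in `x`. -/
lemma append (h : IsPathPartition R S X e d) {x y : V} (hx : x ∈ X) (hy : y ∉ S) (hR : R x y) :
    IsPathPartition R (insert y S) (insert y (X.erase x))
      (fun u => if u = y ∨ e u = x then y else e u)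
      (fun u => if u = y then 0 else if e u = x then d u + 1 else d u) := by
  obtain ⟨h1, h2, h3, h4, h5, h6⟩ := h
  have hyX : y ∉ X := fun hh => hy (h2 hh)
  have hxS := h2 hx
  constructor
  · grind
  · grind
  · grind
  · grind
  · intro u hu w hw
    grind
  · intro u hu k hk
    simp only [Finset.mem_insert] at hu
    by_cases huy : u = y
    · simp [huy] at hk
    have huS : u ∈ S := by tauto
    simp only [huy, if_false, false_or] at hk ⊢
    by_cases hux : e u = x
    · simp only [hux, if_true] at hk ⊢
      rcases Nat.eq_zero_or_pos (d u) with h0 | h0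
      · have : u = x := h5 _ huS _ hxS (by rw [hux, h3 x hx]) (by rw [h0, h4 x hx])
        subst this
        exact ⟨y, by simp, by simp, by simp; omega, hR⟩
      · obtain ⟨w, hw, hew, hdw, hRw⟩ := h6 u huS (d u - 1) (by omega)
        have : w ≠ y := fun hh => hy (hh ▸ hw)
        exact ⟨w, by simp [hw], by simp [hew, hux], by simp [this, hew, hux]; omega, hRw⟩
    · simp only [hux, if_false] at hk ⊢
      obtain ⟨w, hw, hew, hdw, hRw⟩ := h6 u huS k hk
      have : w ≠ y := fun hh => hy (hh ▸ hw)
      exact ⟨w, by simp [hw], by simp [this, hew, hux], by simp [this, hew, hux, hdw], hRw⟩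

/-- A path consisting of a single vertex can be deleted. -/
lemma erase_singleton (h : IsPathPartition R S X e d) {y : V} (hy : y ∈ X)
    (hs : ∀ u ∈ S, e u = y → u = y) :
    IsPathPartition R (S.erase y) (X.erase y) e d := by
  obtain ⟨h1, h2, h3, h4, h5, h6⟩ := h
  constructor
  · grind
  · grind
  · grind
  · grind
  · grind
  · intro u hu k hk
    obtain ⟨w, hw, hew, hdw, hRw⟩ := h6 u (Finset.mem_of_mem_erase hu) k hk
    grind

/-- The last vertex `y` of a path can be deleted; its predecessor `z` becomes the last vertex. -/
lemma erase_end (h : IsPathPartition R S X e d) {y z : V} (hz : z ∈ S) (hez : e z = y)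
    (hdz : d z = 1) :
    IsPathPartition R (S.erase y) (insert z (X.erase y))
      (fun u => if e u = y then z else e u)
      (fun u => if e u = y then d u - 1 else d u) := by
  obtain ⟨h1, h2, h3, h4, h5, h6⟩ := h
  have hy : y ∈ X := hez ▸ h1 z hz
  have hpos : ∀ u ∈ S, e u = y → u ≠ y → 0 < d u := by
    intro u hu heu hne
    rcases Nat.eq_zero_or_pos (d u) with h0 | h0
    · exact absurd (h5 _ hu _ (h2 hy) (by rw [heu, h3 y hy]) (by rw [h0, h4 y hy])) hne
    · exact h0
  have hzy : z ≠ y := by grind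
  have hzX : z ∉ X := by grind
  constructor
  · grind
  · grind
  · grind
  · grind
  · intro u hu w hw
    grind
  · intro u hu k hk
    obtain ⟨huy, huS⟩ := Finset.mem_erase.1 hu
    by_cases heu : e u = y
    · simp only [heu, if_true] at hk ⊢
      obtain ⟨w, hw, hew, hdw, hRw⟩ := h6 u huS (k + 1) (by omega)
      have : w ≠ y := by grind
      exact ⟨w, by simp [hw, this], by simp [hew, heu], by simp [hew, heu, hdw], hRw⟩
    · simp only [heu, if_false] at hk ⊢
      obtain ⟨w, hw, hew, hdw, hRw⟩ := h6 u huS k hk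
      have : w ≠ y := by grind
      exact ⟨w, by simp [hw, this], by simp [hew, heu], by simp [hew, heu, hdw], hRw⟩

/-- The key step of the Gallai–Milgram theorem: a path partition with more paths than the
independence number can be replaced by one whose set of ends has lost an element. -/
lemma exists_erase {a : ℕ} (h : IsPathPartition R S X e d) (ha : a < X.card)
    (hR : ∀ I ⊆ S, a < I.card → ∃ x ∈ I, ∃ y ∈ I, x ≠ y ∧ R x y) :
    ∃ x ∈ X, ∃ e' d', IsPathPartition R S (X.erase x) e' d' := by
  induction hn : S.card generalizing S X e d with
  | zero =>
    have := Finset.card_le_card h.ends_subset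
    omega
  | succ n ih =>
    -- Two ends are joined by an arc x → y. If `y` is a path by itself, move it behind `x`.
    -- Otherwise delete `y`, so that its predecessor `z` becomes an end, and use induction on
    -- `S.erase y`. If the end lost there is `z`, put `y` behind `x`, which is still an end; if not,
    -- put `y` back behind `z`.
    obtain ⟨x, hx, y, hy, hxy, hRxy⟩ := hR X h.ends_subset ha
    have hyS := h.ends_subset hy
    have hins : insert y (S.erase y) = S := Finset.insert_erase hyS
    by_cases hs : ∀ u ∈ S, e u = y → u = y
    · have h' := (h.erase_singleton hy hs).append (x := x) (y := y) (by simp [hx, hxy]) (by simp) hRxy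
      have hX : insert y ((X.erase y).erase x) = X.erase x := by grind
      rw [hins, hX] at h'
      exact ⟨x, hx, _, _, h'⟩
    · push Not at hs
      obtain ⟨u, hu, heu, huy⟩ := hs
      have hdu : 1 ≤ d u := by
        by_contra h0
        exact huy ((h.eq_of_dist_eq_zero hu (by omega)).symm.trans heu)
      obtain ⟨z, hz, hez, hdz⟩ := h.exists_of_le hu hdu
      have hez : e z = y := hez.trans heu
      have hzX : z ∉ X := fun hh => by
        have := h.dist_end z hh
        omega
      have hzy : z ≠ y := fun hh => hzX (hh ▸ hy)
      have hRzy : R z y := by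
        obtain ⟨w, hw, hew, hdw, hRw⟩ := h.exists_next z hz 0 hdz
        have : w = y := by rw [← h.eq_of_dist_eq_zero hw hdw, hew, hez]
        rwa [← this]
      have h1 := h.erase_end hz hez hdz
      have hcard : (insert z (X.erase y)).card = X.card := by
        rw [Finset.card_insert_of_notMem (by simp [hzX]), Finset.card_erase_of_mem hy]
        have := Finset.card_pos.2 ⟨y, hy⟩
        omega
      obtain ⟨w, hw, e', d', h2⟩ := ih h1 (by omega)
        (fun I hI => hR I (hI.trans (Finset.erase_subset _ _)))
        (by rw [Finset.card_erase_of_mem hyS, hn]; rfl)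
      by_cases hwz : w = z
      · have h' := h2.append (x := x) (y := y) (by grind) (by simp) hRxy
        have hX : insert y (((insert z (X.erase y)).erase w).erase x) = X.erase x := by grind
        rw [hins, hX] at h'
        exact ⟨x, hx, _, _, h'⟩
      · have h' := h2.append (x := z) (y := y) (by grind) (by simp) hRzy
        have hX : insert y (((insert z (X.erase y)).erase w).erase z) = X.erase w := by grind
        rw [hins, hX] at h'
        exact ⟨w, by grind, _, _, h'⟩

/-- **Gallai–Milgram theorem**: if every subset of `S` with more than `a` elements spans an arc,
then `S` can be partitioned into at most `a` directed paths. -/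
theorem exists_card_le {a : ℕ}
    (hR : ∀ I ⊆ S, a < I.card → ∃ x ∈ I, ∃ y ∈ I, x ≠ y ∧ R x y) :
    ∃ X e d, IsPathPartition R S X e d ∧ X.card ≤ a := by
  suffices H : ∀ n, ∀ X e d, IsPathPartition R S X e d → X.card = n →
      ∃ X e d, IsPathPartition R S X e d ∧ X.card ≤ a from
    H _ S id _ (singletons R S) rfl
  intro n
  induction n with
  | zero => exact fun X e d h h0 => ⟨X, e, d, h, by omega⟩
  | succ n ih =>
    intro X e d h hc
    by_cases ha : X.card ≤ a
    · exact ⟨X, e, d, h, ha⟩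
    · obtain ⟨x, hx, e', d', h'⟩ := h.exists_erase (by omega) hR
      exact ih _ _ _ h' (by rw [Finset.card_erase_of_mem hx, hc]; rfl)

end IsPathPartition

/-! ### Cycle-free orientations around one vertex -/

/-- A vertex `v` together with a directed path on `r - 1` other vertices from an out-neighbour of
`v` to an in-neighbour of `v` forms a directed cycle of length `r`. -/
lemma not_isFreeOf_directedCycle {V : Type*} {D : Digraph V} {r : ℕ} (hr : 3 ≤ r) {v : V}
    {q : ℕ → V} (hv : ∀ i ≤ r - 2, q i ≠ v)
    (hinj : ∀ i ≤ r - 2, ∀ j ≤ r - 2, q i = q j → i = j)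
    (hq : ∀ i < r - 2, D.Adj (q i) (q (i + 1))) (h0 : D.Adj v (q 0))
    (h1 : D.Adj (q (r - 2)) v) : ¬ IsFreeOf (directedCycle r) D := by
  have : NeZero r := ⟨by omega⟩
  have : Fact (1 < r) := ⟨by omega⟩
  refine not_not.2 ⟨fun i => if i.val = 0 then v else q (i.val - 1), fun i j hij => ?_,
    fun i j hij => ?_⟩
  · have hi := i.val_lt
    have hj := j.val_lt
    apply ZMod.val_injective r
    simp only at hij
    split_ifs at hij with h2 h3 h3
    · omega
    · exact absurd hij.symm (hv _ (by omega))
    · exact absurd hij (hv _ (by omega))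
    · have := hinj _ (by omega) _ (by omega) hij
      omega
  · have hi := i.val_lt
    have hj : j = i + 1 := hij
    subst hj
    rcases Nat.lt_or_ge (i.val + 1) r with h2 | h2
    · have hval : (i + 1).val = i.val + 1 := by
        rw [ZMod.val_add_of_lt, ZMod.val_one]
        rwa [ZMod.val_one]
      simp only [hval]
      by_cases h3 : i.val = 0
      · simpa [h3] using h0
      · obtain ⟨k, hk⟩ := Nat.exists_eq_succ_of_ne_zero h3
        simpa [hk] using hq k (by omega)
    · have hval : (i + 1).val = 0 := by
        rw [ZMod.val_add, ZMod.val_one, show i.val + 1 = r by omega, Nat.mod_self]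
      have h3 : i.val - 1 = r - 2 := by omega
      have h4 : i.val ≠ 0 := by omega
      simpa [hval, h3, h4] using h1

/-- In an orientation without directed `r`-cycles, the out-neighbourhood of `v` is closed under
moving forward by multiples of `r - 2` along paths contained in the neighbourhood of `v`. -/
lemma IsPathPartition.adj_of_mod_eq {V : Type*} {G : SimpleGraph V} {D : Digraph V} {r : ℕ}
    (hr : 3 ≤ r) (hD : IsOrientation G D) (hfree : IsFreeOf (directedCycle r) D) {v : V}
    {R : V → V → Prop} {N X : Finset V} {e : V → V} {d : V → ℕ} (h : IsPathPartition R N X e d)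
    (hN : ∀ u ∈ N, G.Adj v u) (hRD : ∀ u ∈ N, ∀ w ∈ N, R u w → D.Adj u w) {u w : V} (hu : u ∈ N)
    (hw : w ∈ N) (he : e u = e w) (hmod : d u % (r - 2) = d w % (r - 2)) (hle : d w ≤ d u)
    (hadj : D.Adj v u) : D.Adj v w := by
  have step : ∀ u ∈ N, ∀ w ∈ N, e u = e w → d u = d w + (r - 2) → D.Adj v u → D.Adj v w := by
    intro u hu w hw he hd hadj
    obtain ⟨q, hq0, hqm, hqN, hqR, hqi⟩ := h.exists_path hu hw he hd
    rcases (hD.1 v w).1 (hN w hw) with h1 | h1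
    · exact h1
    · refine absurd hfree (not_isFreeOf_directedCycle hr (v := v) (q := q)
        (fun i hi => (hN _ (hqN i hi)).ne') hqi (fun i hi => ?_) (by rwa [hq0]) (by rwa [hqm]))
      exact hRD _ (hqN i hi.le) _ (hqN _ hi) (hqR i hi)
  obtain ⟨m, hm⟩ : ∃ m, d u = d w + m * (r - 2) := by
    obtain ⟨m, hm⟩ := (Nat.modEq_iff_dvd' hle).1 (show d w ≡ d u [MOD r - 2] from hmod.symm)
    exact ⟨m, by rw [mul_comm]; omega⟩
  clear hmod hle
  induction m generalizing u with
  | zero =>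
    have : u = w := h.injOn _ hu _ hw he (by omega)
    rwa [← this]
  | succ m ih =>
    rw [Nat.succ_mul] at hm
    obtain ⟨z, hz, hez, hdz⟩ := h.exists_of_le hu (Nat.sub_le (d u) (r - 2))
    exact ih hz (hez.trans he) (step u hu z hz hez.symm (by omega) hadj) (by omega)

/-- A subset of `N` that is downward closed in each class of `c`, with respect to `d`, is described
by one vertex for each class, where `v ∉ N` encodes the empty set. -/
lemma exists_threshold {V K : Type*} {N : Finset V} {v : V} (hv : v ∉ N) (c : V → K) (d : V → ℕ)
    {A : V → Prop} (hA : ∀ u ∈ N, ∀ w ∈ N, c u = c w → d w ≤ d u → A u → A w) :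
    ∃ g : K → V, ∀ w ∈ N, A w ↔ g (c w) ≠ v ∧ d w ≤ d (g (c w)) := by
  classical
  have : ∀ k, ∃ z, ∀ w ∈ N, c w = k → (A w ↔ z ≠ v ∧ d w ≤ d z) := by
    intro k
    rcases (N.filter fun u => c u = k ∧ A u).eq_empty_or_nonempty with h | h
    · refine ⟨v, fun w hw hc => ?_⟩
      have := Finset.eq_empty_iff_forall_notMem.1 h w
      simp_all
    · obtain ⟨z, hz, hmax⟩ := Finset.exists_max_image _ d h
      simp only [Finset.mem_filter] at hz hmax
      refine ⟨z, fun w hw hc => ⟨fun hAw => ⟨fun hzv => hv (hzv ▸ hz.1), hmax w ⟨hw, hc, hAw⟩⟩,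
        fun hd => hA z hz.1 w hw (hz.2.1.trans hc.symm) hd.2 hz.2.2⟩⟩
  choose g hg using this
  exact ⟨g, fun w hw => hg _ w hw rfl⟩

/-! ### Counting orientations vertex by vertex -/

/-- The arcs of the digraph `D` with both ends in `T`. -/
def Digraph.arcsIn {V : Type*} (D : Digraph V) (T : Finset V) : Set (V × V) :=
  {x | x.1 ∈ T ∧ x.2 ∈ T ∧ D.Adj x.1 x.2}

lemma Digraph.adj_iff_of_arcsIn_eq {V : Type*} {D D' : Digraph V} {T : Finset V}
    (h : D.arcsIn T = D'.arcsIn T) {u w : V} (hu : u ∈ T) (hw : w ∈ T) :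
    D.Adj u w ↔ D'.Adj u w := by
  have := Set.ext_iff.1 h (u, w)
  simpa [Digraph.arcsIn, hu, hw] using this

open Classical in
/-- The restrictions to `T` of the `C_r`-free orientations of `G`. -/
noncomputable def freeRestrictions {V : Type*} [Fintype V] (G : SimpleGraph V) (r : ℕ)
    (T : Finset V) : Finset (Set (V × V)) :=
  Finset.univ.filter fun E =>
    ∃ D : Digraph V, (IsOrientation G D ∧ IsFreeOf (directedCycle r) D) ∧ D.arcsIn T = E

lemma mem_freeRestrictions {V : Type*} [Fintype V] {G : SimpleGraph V} {r : ℕ} {T : Finset V}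
    {E : Set (V × V)} : E ∈ freeRestrictions G r T ↔
    ∃ D : Digraph V, (IsOrientation G D ∧ IsFreeOf (directedCycle r) D) ∧ D.arcsIn T = E := by
  simp [freeRestrictions]

open Classical in
/-- A `C_r`-free orientation on `T` extends to a further vertex in few ways. -/
lemma card_extensions_le {V : Type*} [Fintype V] {G : SimpleGraph V} {r a : ℕ}
    (hr : 3 ≤ r) (hG : ∀ I : Finset V, a < I.card → ∃ x ∈ I, ∃ y ∈ I, G.Adj x y)
    {T : Finset V} {v : V} (hv : v ∉ T) {D₀ : Digraph V} (hD₀ : IsOrientation G D₀) :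
    ((freeRestrictions G r (insert v T)).filter
      fun E => {x ∈ E | x.1 ∈ T ∧ x.2 ∈ T} = D₀.arcsIn T).card ≤
      Fintype.card V ^ ((r - 2) * a) := by
  set N : Finset V := T.filter fun u => G.Adj v u with hN
  -- The paths depend only on `D₀` inside `T`, where all counted orientations agree, so one
  -- partition serves to code them all.
  obtain ⟨X, e, d, hP, hXa⟩ : ∃ X e d, IsPathPartition (fun u w => D₀.Adj u w ∧ u ∈ N ∧ w ∈ N)
      N X e d ∧ X.card ≤ a := by
    refine IsPathPartition.exists_card_le fun I hI hIa => ?_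
    obtain ⟨x, hx, y, hy, hxy⟩ := hG I hIa
    rcases (hD₀.1 x y).1 hxy with h | h
    · exact ⟨x, hx, y, hy, hxy.ne, h, hI hx, hI hy⟩
    · exact ⟨y, hy, x, hx, hxy.ne', h, hI hy, hI hx⟩
  have hvN : v ∉ N := fun h => hv (Finset.mem_filter.1 h).1
  set c : V → V × ℕ := fun u => (e u, d u % (r - 2)) with hc
  set K : Finset (V × ℕ) := X ×ˢ Finset.range (r - 2) with hK
  have hcK : ∀ u ∈ N, c u ∈ K := fun u hu => Finset.mem_product.2
    ⟨hP.mem_ends u hu, Finset.mem_range.2 (Nat.mod_lt _ (by omega))⟩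
  have hrestrict : ∀ D : Digraph V,
      {x ∈ D.arcsIn (insert v T) | x.1 ∈ T ∧ x.2 ∈ T} = D.arcsIn T := by
    intro D
    ext x
    simp only [Digraph.arcsIn, Set.mem_ofPred_eq, Finset.mem_insert]
    tauto
  have key : ∀ E ∈ (freeRestrictions G r (insert v T)).filter
      (fun E => {x ∈ E | x.1 ∈ T ∧ x.2 ∈ T} = D₀.arcsIn T),
      ∃ D : Digraph V, ∃ g : V × ℕ → V, IsOrientation G D ∧ D.arcsIn (insert v T) = E ∧
        D.arcsIn T = D₀.arcsIn T ∧ ∀ w ∈ N, D.Adj v w ↔ g (c w) ≠ v ∧ d w ≤ d (g (c w)) := by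
    intro E hE
    obtain ⟨hE, hET⟩ := Finset.mem_filter.1 hE
    obtain ⟨D, ⟨hD, hfree⟩, rfl⟩ := mem_freeRestrictions.1 hE
    rw [hrestrict] at hET
    obtain ⟨g, hg⟩ := exists_threshold (A := fun w => D.Adj v w) hvN c d
      (fun u hu w hw hcuw hle hadj => by
        simp only [hc, Prod.mk.injEq] at hcuw
        refine hP.adj_of_mod_eq hr hD hfree (fun z hz => (Finset.mem_filter.1 hz).2) ?_ hu hw
          hcuw.1 hcuw.2 hle hadj
        intro z hz y hy hzy
        exact (Digraph.adj_iff_of_arcsIn_eq hET (Finset.mem_filter.1 hz).1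
          (Finset.mem_filter.1 hy).1).2 hzy.1)
    exact ⟨D, g, hD, rfl, hET, hg⟩
  have : Nonempty V := ⟨v⟩
  choose! D g hD hDE hDT hg using key
  calc _ ≤ (Finset.univ : Finset (K → V)).card := by
        -- The thresholds determine the out-neighbours of `v`; its other neighbours in `T` are
        -- in-neighbours, and the arcs inside `T` are those of `D₀`.
        refine Finset.card_le_card_of_injOn (fun E k => g E k)
          (fun _ _ => Finset.mem_coe.2 (Finset.mem_univ _)) ?_
        intro E hE E' hE' hEE'
        have hout : ∀ w ∈ T, (D E).Adj v w ↔ (D E').Adj v w := by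
          intro w hw
          by_cases hwN : w ∈ N
          · rw [hg E hE w hwN, hg E' hE' w hwN]
            have : g E (c w) = g E' (c w) := congrFun hEE' ⟨c w, hcK w hwN⟩
            rw [this]
          · have hnadj : ¬ G.Adj v w := fun h => hwN (Finset.mem_filter.2 ⟨hw, h⟩)
            exact iff_of_false (fun h => hnadj (((hD E hE).1 _ _).2 (Or.inl h)))
              (fun h => hnadj (((hD E' hE').1 _ _).2 (Or.inl h)))
        have hin : ∀ w ∈ T, (D E).Adj w v ↔ (D E').Adj w v := by
          intro w hw
          have h1 := (hD E hE).1 v w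
          have h2 := (hD E' hE').1 v w
          have h3 := (hD E hE).2 v w
          have h4 := (hD E' hE').2 v w
          have h5 := hout w hw
          tauto
        have hloop : ∀ E ∈ _, ¬ (D E).Adj v v := fun E hE h => (hD E hE).2 v v h h
        rw [← hDE E hE, ← hDE E' hE']
        ext ⟨x, y⟩
        simp only [Digraph.arcsIn, Set.mem_ofPred_eq, Finset.mem_insert]
        refine and_congr_right fun hx => and_congr_right fun hy => ?_
        rcases hx with rfl | hx <;> rcases hy with rfl | hy
        · exact iff_of_false (hloop E hE) (hloop E' hE')
        · exact hout _ hy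
        · exact hin _ hx
        · exact Digraph.adj_iff_of_arcsIn_eq ((hDT E hE).trans (hDT E' hE').symm) hx hy
    _ = Fintype.card V ^ (X.card * (r - 2)) := by simp [hK]
    _ ≤ Fintype.card V ^ ((r - 2) * a) := by
        refine Nat.pow_le_pow_right (Fintype.card_pos_iff.2 ⟨v⟩) ?_
        rw [mul_comm]
        exact Nat.mul_le_mul_left _ hXa

/-- Induction on `T`: the fibres of the restriction map from `insert v T` to `T` are bounded by
`card_extensions_le`. -/
lemma card_freeRestrictions_le {V : Type*} [Fintype V] {G : SimpleGraph V} {r a : ℕ}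
    (hr : 3 ≤ r) (hG : ∀ I : Finset V, a < I.card → ∃ x ∈ I, ∃ y ∈ I, G.Adj x y) (T : Finset V) :
    (freeRestrictions G r T).card ≤ Fintype.card V ^ ((r - 2) * a * T.card) := by
  classical
  induction T using Finset.induction_on with
  | empty =>
    refine (Finset.card_le_one.2 fun E hE E' hE' => ?_).trans (by simp)
    obtain ⟨D, -, rfl⟩ := mem_freeRestrictions.1 hE
    obtain ⟨D', -, rfl⟩ := mem_freeRestrictions.1 hE'
    simp [Digraph.arcsIn]
  | insert v T hv ih =>
    rw [Finset.card_insert_of_notMem hv, Nat.mul_add_one, pow_add, mul_comm]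
    refine (Finset.card_le_mul_card_image_of_maps_to (f := fun E => {x ∈ E | x.1 ∈ T ∧ x.2 ∈ T})
      (t := freeRestrictions G r T) ?_ (Fintype.card V ^ ((r - 2) * a)) ?_).trans
      (Nat.mul_le_mul_left _ ih)
    · intro E hE
      obtain ⟨D, hD, rfl⟩ := mem_freeRestrictions.1 hE
      refine mem_freeRestrictions.2 ⟨D, hD, ?_⟩
      ext x
      simp only [Digraph.arcsIn, Set.mem_ofPred_eq, Finset.mem_insert]
      tauto
    · intro E hE
      obtain ⟨D, hD, rfl⟩ := mem_freeRestrictions.1 hE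
      exact card_extensions_le hr hG hv hD.1

/-- If every set of more than `a` vertices spans an edge of the graph `G` on `n` vertices, then `G`
has at most `n ^ ((r - 2) * a * n)` orientations without directed cycles of length `r`. -/
theorem numFreeOrientations_directedCycle_le {V : Type*} [Fintype V] {G : SimpleGraph V} {r a : ℕ}
    (hr : 3 ≤ r) (hG : ∀ I : Finset V, a < I.card → ∃ x ∈ I, ∃ y ∈ I, G.Adj x y) :
    numFreeOrientations G (directedCycle r) ≤
      Fintype.card V ^ ((r - 2) * a * Fintype.card V) := by
  classical
  refine le_trans ?_ (card_freeRestrictions_le hr hG Finset.univ)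
  rw [numFreeOrientations, ← Fintype.card_coe, ← Nat.card_eq_fintype_card]
  refine Nat.card_le_card_of_injective
    (fun D => ⟨D.1.arcsIn Finset.univ, mem_freeRestrictions.2 ⟨D.1, D.2, rfl⟩⟩) ?_
  rintro ⟨D, hD⟩ ⟨D', hD'⟩ h
  simp only [Subtype.mk.injEq] at h ⊢
  ext x y
  exact Digraph.adj_iff_of_arcsIn_eq h (Finset.mem_univ x) (Finset.mem_univ y)

/-! ### Independent sets in the binomial random graph -/

open MeasureTheory ProbabilityTheory in
/-- The probability that a given set of vertices is independent in the binomial random graph. -/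
lemma binomialRandom_independent_le {V : Type*} [Fintype V] [DecidableEq V] (p : unitInterval)
    (I : Finset V) :
    SimpleGraph.binomialRandom V p {G | ∀ x ∈ I, ∀ y ∈ I, ¬ G.Adj x y} ≤
      ENNReal.ofReal (Real.exp (-(p * (I.card.choose 2 : ℕ)))) := by
  set F : Finset (Sym2 V) := I.offDiag.image Sym2.mk.uncurry with hF
  have hFd : ∀ e ∈ F, ¬ e.IsDiag := by
    intro e he
    obtain ⟨⟨x, y⟩, hxy, rfl⟩ := Finset.mem_image.1 he
    simpa using (Finset.mem_offDiag.1 hxy).2.2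
  rw [SimpleGraph.binomialRandom_apply]
  calc _ ≤ _ := measure_mono (t := Set.pi (F : Set (Sym2 V)) fun _ => {False}) ?_
    _ = ∏ e ∈ F, (unitInterval.toNNReal (unitInterval.symm p) : ENNReal) := by
      rw [Measure.infinitePi_pi _ (by simp)]
      refine Finset.prod_congr rfl fun e he => ?_
      simp [hFd e he]
    _ = (unitInterval.toNNReal (unitInterval.symm p) : ENNReal) ^ I.card.choose 2 := by
      rw [Finset.prod_const, hF, Sym2.card_image_offDiag]
    _ = ENNReal.ofReal (1 - p) ^ I.card.choose 2 := by
      rw [← unitInterval.coe_symm_eq, ← unitInterval.coe_toNNReal, ENNReal.ofReal_coe_nnreal]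
    _ ≤ _ := by
      rw [← ENNReal.ofReal_pow (by linarith [p.2.2])]
      refine ENNReal.ofReal_le_ofReal ?_
      rw [show -((p : ℝ) * (I.card.choose 2 : ℕ)) = (I.card.choose 2 : ℕ) * (-(p : ℝ)) by ring,
        Real.exp_nat_mul]
      refine pow_le_pow_left₀ (by linarith [p.2.2]) ?_ _
      linarith [Real.add_one_le_exp (-(p : ℝ))]
  rintro _ ⟨G, hG, rfl⟩ e he
  obtain ⟨⟨x, y⟩, hxy, rfl⟩ := Finset.mem_image.1 (Finset.mem_coe.1 he)
  have := Finset.mem_offDiag.1 hxy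
  simpa using hG x this.1 y this.2.1

/-- First moment bound for independent sets of more than `a` vertices in `G(n, p)`. -/
lemma binomialRandom_exists_independent_le {V : Type*} [Fintype V] (p : unitInterval) (a : ℕ) :
    SimpleGraph.binomialRandom V p
      {G | ¬ ∀ I : Finset V, a < I.card → ∃ x ∈ I, ∃ y ∈ I, G.Adj x y} ≤
      ENNReal.ofReal ((Fintype.card V * Real.exp (-(p * a / 2))) ^ (a + 1)) := by
  classical
  calc _ ≤ SimpleGraph.binomialRandom V p (⋃ I ∈ Finset.powersetCard (a + 1) Finset.univ,
          {G | ∀ x ∈ I, ∀ y ∈ I, ¬ G.Adj x y}) := by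
        refine MeasureTheory.measure_mono fun G hG => ?_
        simp only [Set.mem_ofPred_eq] at hG
        push Not at hG
        obtain ⟨I, hI, hIG⟩ := hG
        obtain ⟨J, hJI, hJ⟩ := Finset.exists_subset_card_eq (Nat.succ_le_of_lt hI)
        simp only [Set.mem_iUnion]
        exact ⟨J, Finset.mem_powersetCard.2 ⟨Finset.subset_univ _, hJ⟩,
          fun x hx y hy => hIG x (hJI hx) y (hJI hy)⟩
    _ ≤ ∑ I ∈ Finset.powersetCard (a + 1) (Finset.univ : Finset V),
          ENNReal.ofReal (Real.exp (-(p * ((a + 1).choose 2 : ℕ)))) := by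
        refine (MeasureTheory.measure_biUnion_finset_le _ _).trans
          (Finset.sum_le_sum fun I hI => ?_)
        rw [← (Finset.mem_powersetCard.1 hI).2]
        exact binomialRandom_independent_le p I
    _ = ENNReal.ofReal ((Fintype.card V).choose (a + 1) *
          Real.exp (-(p * ((a + 1).choose 2 : ℕ)))) := by
        rw [Finset.sum_const, Finset.card_powersetCard, Finset.card_univ,
          ENNReal.ofReal_mul (by positivity), ENNReal.ofReal_natCast, nsmul_eq_mul]
    _ ≤ _ := by
        refine ENNReal.ofReal_le_ofReal ?_
        -- Since C(a+1, 2) = (a+1)a/2 and C(n, a+1) ≤ n^(a+1), the bound is a perfect (a+1)-th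
        -- power.
        rw [mul_pow, ← Real.exp_nat_mul]
        have h2 : (((a + 1).choose 2 : ℕ) : ℝ) = (a + 1) * a / 2 := by
          rw [Nat.cast_choose_two]
          push_cast
          ring
        refine mul_le_mul ?_ (le_of_eq ?_) (by positivity) (by positivity)
        · exact_mod_cast Nat.choose_le_pow _ _
        · rw [h2]
          push_cast
          congr 1
          ring

/-- With high probability, `G(n, p)` has no independent set of more than `6 log n / p` vertices. -/
lemma withHighProbability_independent (p : ℕ → unitInterval) (hp : ∀ n, 0 < p n) :
    WithHighProbability p (fun n => {G : SimpleGraph (Fin n) |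
      ∀ I : Finset (Fin n), ⌊6 * Real.log n / p n⌋₊ < I.card →
        ∃ x ∈ I, ∃ y ∈ I, G.Adj x y}) := by
  have hlim : Tendsto (fun n : ℕ => 1 - ENNReal.ofReal (2 / n)) atTop (𝓝 1) := by
    have h := ENNReal.tendsto_ofReal (tendsto_const_div_atTop_nhds_zero_nat (2 : ℝ))
    simpa using ENNReal.Tendsto.sub (tendsto_const_nhds (x := (1 : ENNReal))) h
      (Or.inl ENNReal.one_ne_top)
  refine tendsto_of_tendsto_of_tendsto_of_le_of_le' hlim tendsto_const_nhds ?_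
    (Eventually.of_forall fun n => MeasureTheory.prob_le_one)
  filter_upwards [eventually_ge_atTop 2] with n hn
  rw [tsub_le_iff_right]
  set a := ⌊6 * Real.log n / p n⌋₊ with ha
  have hn' : (2 : ℝ) ≤ n := by exact_mod_cast hn
  have hp0 : (0 : ℝ) < p n := hp n
  have hp1 : (p n : ℝ) ≤ 1 := (p n).2.2
  -- The 1/2 pays for the floor, using p ≤ 1.
  have hpa : 3 * Real.log n - 1 / 2 ≤ p n * a / 2 := by
    have h1 : 6 * Real.log n / p n < a + 1 := Nat.lt_floor_add_one _
    rw [div_lt_iff₀ hp0] at h1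
    linarith
  have hbase : n * Real.exp (-(p n * a / 2)) ≤ 2 / n := by
    have hexp : Real.exp (1 / 2) ≤ 2 := by
      rw [← Real.le_log_iff_exp_le (by norm_num)]
      linarith [Real.log_two_gt_d9]
    have hlog : Real.exp (-(2 * Real.log n)) = 1 / (n : ℝ) ^ 2 := by
      rw [Real.exp_neg, mul_comm, Real.exp_mul, Real.exp_log (by linarith)]
      norm_num
    have hlog2 : 0 ≤ Real.log n := Real.log_nonneg (by linarith)
    calc n * Real.exp (-(p n * a / 2)) ≤ n * (Real.exp (1 / 2) * Real.exp (-(2 * Real.log n))) := by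
          rw [← Real.exp_add]
          gcongr
          linarith
      _ ≤ n * (2 * (1 / (n : ℝ) ^ 2)) := by
          rw [hlog]
          gcongr
      _ = 2 / n := by
          field_simp
  -- The base is at most 2/n ≤ 1 and the exponent is at least 1, so the power is at most the base.
  have hle : (n * Real.exp (-(p n * a / 2))) ^ (a + 1) ≤ 2 / n :=
    (pow_le_of_le_one (by positivity)
      (hbase.trans ((div_le_one (by linarith)).2 hn')) (by omega)).trans hbase
  have hcompl : SimpleGraph.binomialRandom (Fin n) (p n) {G : SimpleGraph (Fin n) |
      ¬ ∀ I : Finset (Fin n), a < I.card → ∃ x ∈ I, ∃ y ∈ I, G.Adj x y} ≤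
      ENNReal.ofReal (2 / n) := by
    refine (binomialRandom_exists_independent_le (p n) a).trans (ENNReal.ofReal_le_ofReal ?_)
    rwa [Fintype.card_fin]
  calc (1 : ENNReal) = SimpleGraph.binomialRandom (Fin n) (p n) Set.univ :=
        MeasureTheory.measure_univ.symm
    _ ≤ _ := by
        rw [← Set.union_compl_self {G : SimpleGraph (Fin n) |
          ∀ I : Finset (Fin n), a < I.card → ∃ x ∈ I, ∃ y ∈ I, G.Adj x y}]
        exact (MeasureTheory.measure_union_le _ _).trans (add_le_add_right hcompl _)

/-! ### Combining the two bounds -/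

lemma WithHighProbability.mono {p : ℕ → unitInterval} {E F : (n : ℕ) → Set (SimpleGraph (Fin n))}
    (h : WithHighProbability p E) (hEF : ∀ᶠ n in atTop, E n ⊆ F n) : WithHighProbability p F :=
  tendsto_of_tendsto_of_tendsto_of_le_of_le' h tendsto_const_nhds
    (hEF.mono fun _ hn => MeasureTheory.measure_mono hn)
    (Eventually.of_forall fun _ => MeasureTheory.prob_le_one)

lemma withHighProbability_numFreeOrientations_le {r : ℕ} (hr : 3 ≤ r) (p : ℕ → unitInterval)
    (hp : ∀ n, 0 < p n) :
    WithHighProbability p (fun n => {G : SimpleGraph (Fin n) |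
      (numFreeOrientations G (directedCycle r) : ℝ) ≤
        Real.exp (6 * (n : ℝ) * ((r : ℝ) - 2) * Real.log (n : ℝ) ^ 2 / (p n : ℝ))}) := by
  refine (withHighProbability_independent p hp).mono ?_
  filter_upwards [eventually_ge_atTop 1] with n hn G hG
  have hn' : (1 : ℝ) ≤ n := by exact_mod_cast hn
  have hp0 : (0 : ℝ) < p n := hp n
  have hlog : 0 ≤ Real.log n := Real.log_nonneg hn'
  have hr' : (0 : ℝ) ≤ (r : ℝ) - 2 := by
    have : (3 : ℝ) ≤ r := by exact_mod_cast hr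
    linarith
  have ha : (⌊6 * Real.log n / p n⌋₊ : ℝ) ≤ 6 * Real.log n / p n :=
    Nat.floor_le (by positivity)
  have h := numFreeOrientations_directedCycle_le hr hG
  rw [Fintype.card_fin] at h
  calc (numFreeOrientations G (directedCycle r) : ℝ)
      ≤ (n : ℝ) ^ ((r - 2) * ⌊6 * Real.log n / p n⌋₊ * n) := by exact_mod_cast h
    -- One factor log n comes from the independence number, the other from the n choices for each
    -- threshold.
    _ = Real.exp (((r : ℝ) - 2) * ⌊6 * Real.log n / p n⌋₊ * n * Real.log n) := by
        rw [← Real.exp_log (show (0 : ℝ) < n by linarith), ← Real.exp_nat_mul,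
          Real.exp_log (by linarith)]
        push_cast [Nat.cast_sub (show 2 ≤ r by omega)]
        rfl
    _ ≤ Real.exp (((r : ℝ) - 2) * (6 * Real.log n / p n) * n * Real.log n) := by
        gcongr
    _ = _ := by
        congr 1
        ring

theorem theorem6p1 (r : ℕ) (hr : 3 ≤ r) :
    (∃ C : ℝ, 0 < C ∧ ∃ k : ℕ, ∀ p : ℕ → unitInterval, (∀ n, 0 < p n) →
      WithHighProbability p (fun n => {G : SimpleGraph (Fin n) |
        Real.log (numFreeOrientations G (directedCycle r) : ℝ) ≤
          C * Real.log (n : ℝ) ^ k * ((n : ℝ) / (p n : ℝ))})) ∧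
    (∀ p : ℕ → unitInterval, (∀ n, 0 < p n) →
      WithHighProbability p (fun n => {G : SimpleGraph (Fin n) |
        (numFreeOrientations G (directedCycle r) : ℝ) ≤
          Real.exp (6 * (n : ℝ) * ((r : ℝ) - 2) * Real.log (n : ℝ) ^ 2 / (p n : ℝ))})) := by
  have hr' : (3 : ℝ) ≤ r := by exact_mod_cast hr
  refine ⟨⟨6 * ((r : ℝ) - 2), by linarith, 2, fun p hp => ?_⟩,
    fun p hp => withHighProbability_numFreeOrientations_le hr p hp⟩
  refine (withHighProbability_numFreeOrientations_le hr p hp).mono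
    (Eventually.of_forall fun n G hG => ?_)
  have hp0 : (0 : ℝ) < p n := hp n
  have heq : 6 * ((r : ℝ) - 2) * Real.log n ^ 2 * ((n : ℝ) / p n) =
      6 * (n : ℝ) * ((r : ℝ) - 2) * Real.log (n : ℝ) ^ 2 / (p n : ℝ) := by ring
  simp only [Set.mem_ofPred_eq] at hG ⊢
  rw [heq]
  -- Acyclic orientations make the zero case void, but the convention `Real.log 0 = 0` settles it
  -- without them.
  rcases Nat.eq_zero_or_pos (numFreeOrientations G (directedCycle r)) with h0 | h0
  · rw [h0, Nat.cast_zero, Real.log_zero]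
    have : 0 ≤ (r : ℝ) - 2 := by linarith
    positivity
  · exact (Real.log_le_iff_le_exp (by exact_mod_cast h0)).2 hG
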